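/- Let $(R,\mathfrak m,k)$ be a commutative Noetherian local ring that is Cohen--Macaulay (that is, its depth, the supremum of the lengths of $R$-regular sequences in $\mathfrak m$, equals its Krull dimension), and suppose that $d=\dim R\ge 3$. For an arbitrary $R$-module $M$, let the Ext-depth of $M$ be $\inf\{i\ge 0 : \operatorname{Ext}^i_R(k,M)\neq 0\}$ (and $\infty$ if there is no such $i$), and let $\mathcal H$ be the class of all $R$-modules $M$ with $\operatorname{Ext}^i_R(k,M)=0$ for all $i<d$, i.e. of all $R$-modules of Ext-depth at least $d$. Then: 1. there exists an $R$-module $M$ with $2\le \operatorname{Ext-depth}(M)\le d-1$; 2. every $R$-module $M$ with $2\le \operatorname{Ext-depth}(M)\le d-1$ is (isomorphic to) the inverse limit of a countable inverse system $\cdots\to T_2\to T_1\to T_0$, indexed by $\mathbb N$, of modules in $\mathcal H$; 3. consequently, $\mathcal H$ is not closed under inverse limits: there is an inverse system of modules in $\mathcal H$, indexed by a nonempty directed partially ordered set, whose limit is not in $\mathcal H$. -/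

import Mathlib

universe u

open CategoryTheory

section

variable (R : Type u) [CommRing R] [IsLocalRing R]

/-- The classical depth of an `R`-module `M` over a local ring `(R, 𝔪)`: the supremum of the lengths
of the `M`-regular sequences with entries in `𝔪`. -/
noncomputable def moduleDepth (M : Type u) [AddCommGroup M] [Module R M] : ℕ∞ :=
  sSup {n : ℕ∞ | ∃ rs : List R, (∀ r ∈ rs, r ∈ IsLocalRing.maximalIdeal R) ∧
    RingTheory.Sequence.IsRegular M rs ∧ n = rs.length}

/-- A (Noetherian) local ring is Cohen-Macaulay if its depth equals its Krull dimension. -/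
def IsCohenMacaulayLocal : Prop :=
  ((moduleDepth R R : ℕ∞) : WithBot ℕ∞) = ringKrullDim R

/-- The Ext-depth of a module `M` over a local ring with residue field `k`: the infimum of
all `i ≥ 0` with `Ext^i_R(k, M) ≠ 0`, with value `⊤` when there is no such `i`. -/
noncomputable def extDepth (M : ModuleCat.{u} R) : ℕ∞ :=
  sInf {n : ℕ∞ | ∃ i : ℕ, n = i ∧
    Nontrivial (Abelian.Ext (ModuleCat.of R (IsLocalRing.ResidueField R)) M i)}

/-- The class of all `R`-modules `M` (not necessarily finitely generated) such that
`Ext^i_R(k, M) = 0` for all `i < dim R`. -/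
def homologicalCM : ObjectProperty (ModuleCat.{u} R) := fun M =>
  ∀ i : ℕ, ((i : ℕ∞) : WithBot ℕ∞) < ringKrullDim R →
    Subsingleton (Abelian.Ext (ModuleCat.of R (IsLocalRing.ResidueField R)) M i)

end

/-- A class of modules is closed under inverse limits if, for every inverse system of modules in
the class indexed by a nonempty directed partially ordered set, its limit is in the class. -/
def ClosedUnderInverseLimits {R : Type u} [CommRing R]
    (P : ObjectProperty (ModuleCat.{u} R)) : Prop :=
  ∀ (I : Type u) [PartialOrder I] [Nonempty I] [IsDirectedOrder I],
    P.IsClosedUnderLimitsOfShape Iᵒᵖ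

/-!
Write `k` for the residue field and `𝔪` for the maximal ideal. `Ext^i(k, N)` is killed by `𝔪`, so
it vanishes for all `i` as soon as the identity of `N` lies in `𝔪 • End N`
(`EndDivisible.subsingleton_ext`). Localizations `N_x` with `x ∈ 𝔪` have this property, and it
passes to finite products and to direct sums of copies. It takes the place of injectivity here.

A module `M` without socle embeds into a finite product of localizations `M_x`, for `x` running
through generators of `𝔪`. If `M` has Ext-depth at least two, then the cokernel of this embedding
has no socle either, and embedding it in the same way writes `M` as the kernel of a map `f : E → F`
between modules all of whose `Ext^i(k, -)` vanish (`exists_ker_eq_range_of_subsingleton_ext`).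

A kernel becomes an inverse limit along `ℕ` through the decreasing sequence of submodules of
`E × F^ℕ` whose term `T n` consists of the pairs `(e, x)` such that `x` is zero before the place `n`
and equal to `f e` at almost all places. Each `T n` is isomorphic to `E × F^(ℕ)`, hence has
vanishing `Ext^i(k, -)`, whereas an element of the intersection has `x = 0` and thus `f e = 0`
(`mem_iInf_range_towerMap`).

A module of Ext-depth exactly two is the second syzygy of `k` (`exists_extDepth_eq_two`): dimension
shifting carries `Hom(k, k) ≠ 0` to `Ext^2`, because by Rees's theorem `Ext^i(k, R) = 0` for
`i < 2`. Its presentation as an inverse limit shows that the class is not closed under such limits.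
-/

/-! ### Modules whose identity lies in `I • End N` -/

section Divisible

/-- An `R`-module `N` is `I`-divisible through endomorphisms if the identity of `N` is a finite sum
`∑ xᵢ • qᵢ` with `xᵢ ∈ I` and `qᵢ` endomorphisms of `N`. This is the case for instance if
some `x ∈ I` acts bijectively on `N`. -/
def EndDivisible {R : Type*} [CommRing R] (I : Ideal R) (N : Type*) [AddCommGroup N]
    [Module R N] : Prop :=
  (LinearMap.id : N →ₗ[R] N) ∈ I • (⊤ : Submodule R (N →ₗ[R] N))

variable {R : Type*} [CommRing R] {I : Ideal R} {N N' : Type*} [AddCommGroup N] [Module R N]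
  [AddCommGroup N'] [Module R N']

/-- A linear map between endomorphism modules sends `I • End N` to `I • End N'`; all closure
properties of `EndDivisible` come from this. -/
lemma EndDivisible.map_mem (h : EndDivisible I N) (φ : (N →ₗ[R] N) →ₗ[R] (N' →ₗ[R] N')) :
    φ LinearMap.id ∈ I • (⊤ : Submodule R (N' →ₗ[R] N')) := by
  have := Submodule.mem_map_of_mem (f := φ) h
  rw [Submodule.map_smul''] at this
  exact Submodule.smul_mono le_rfl le_top this

lemma EndDivisible.of_linearEquiv (h : EndDivisible I N) (e : N ≃ₗ[R] N') :
    EndDivisible I N' := by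
  have := h.map_mem e.conj.toLinearMap
  simpa [EndDivisible] using this

lemma EndDivisible.prod (h : EndDivisible I N) (h' : EndDivisible I N') :
    EndDivisible I (N × N') := by
  have h₁ := h.map_mem (N' := N × N')
    (LinearMap.lcomp R _ (LinearMap.fst R N N') ∘ₗ LinearMap.compRight R (LinearMap.inl R N N'))
  have h₂ := h'.map_mem (N' := N × N')
    (LinearMap.lcomp R _ (LinearMap.snd R N N') ∘ₗ LinearMap.compRight R (LinearMap.inr R N N'))
  have := add_mem h₁ h₂
  unfold EndDivisible
  convert this using 1
  ext <;> simp

lemma EndDivisible.pi {ι : Type*} [Finite ι] {P : ι → Type*} [∀ i, AddCommGroup (P i)]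
    [∀ i, Module R (P i)] (h : ∀ i, EndDivisible I (P i)) : EndDivisible I (∀ i, P i) := by
  classical
  have := Fintype.ofFinite ι
  have h₁ (i : ι) := (h i).map_mem (N' := ∀ i, P i)
    (LinearMap.lcomp R _ (LinearMap.proj (R := R) (φ := P) i) ∘ₗ
      LinearMap.compRight R (LinearMap.single R P i))
  have := sum_mem (t := Finset.univ) fun i _ ↦ h₁ i
  unfold EndDivisible
  convert this using 1
  refine LinearMap.ext fun v ↦ ?_
  simpa using (Finset.univ_sum_single v).symm

lemma EndDivisible.finsupp {ι : Type*} (h : EndDivisible I N) : EndDivisible I (ι →₀ N) := by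
  have := h.map_mem (N' := ι →₀ N)
    { toFun := fun q ↦ Finsupp.mapRange.linearMap q
      map_add' := fun p q ↦ by ext; simp
      map_smul' := fun r q ↦ by ext; simp }
  simpa [EndDivisible] using this

lemma EndDivisible.localizedModule {x : R} (hx : x ∈ I) :
    EndDivisible I (LocalizedModule (Submonoid.powers x) N) := by
  have hu := IsLocalizedModule.map_units (S := Submonoid.powers x)
    (LocalizedModule.mkLinearMap (Submonoid.powers x) N) ⟨x, Submonoid.mem_powers x⟩
  obtain ⟨q, hq⟩ := hu.exists_right_inv
  have : (LinearMap.id : LocalizedModule (Submonoid.powers x) N →ₗ[R] _) = x • q := by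
    refine LinearMap.ext fun v ↦ ?_
    exact (LinearMap.congr_fun hq v).symm
  unfold EndDivisible
  rw [this]
  exact Submodule.smul_mem_smul hx trivial

/-- If `I` is finitely generated and no nonzero element of `N` is killed by `I`, then `N` embeds
into the product of its localizations at finitely many generators of `I`. -/
lemma exists_injective_endDivisible {R N : Type u} [CommRing R] {I : Ideal R} (hI : I.FG)
    [AddCommGroup N] [Module R N] (h : ∀ z : N, (∀ r ∈ I, r • z = 0) → z = 0) :
    ∃ (E : Type u) (_ : AddCommGroup E) (_ : Module R E) (j : N →ₗ[R] E),
      EndDivisible I E ∧ Function.Injective j := by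
  -- Elements killed by a power of `I` vanish too.
  have key (n : ℕ) (z : N) (hz : ∀ r ∈ I ^ n, r • z = 0) : z = 0 := by
    induction n generalizing z with
    | zero => simpa using hz 1 (by simp)
    | succ n ih =>
      refine h z fun r hr ↦ ih _ fun s hs ↦ ?_
      rw [smul_smul]
      exact hz _ (pow_succ I n ▸ Ideal.mul_mem_mul hs hr)
  obtain ⟨s, hs⟩ := hI
  refine ⟨∀ x : s, LocalizedModule (Submonoid.powers x.1) N, inferInstance, inferInstance,
    LinearMap.pi fun x ↦ LocalizedModule.mkLinearMap _ N, .pi fun x ↦ .localizedModule ?_, ?_⟩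
  · exact hs ▸ Ideal.subset_span x.2
  · rw [injective_iff_map_eq_zero]
    intro z hz
    have hrad : I ≤ (Ideal.torsionOf R N z).radical := by
      rw [← hs, Ideal.span_le]
      intro x hx
      have hzx := congrFun hz ⟨x, hx⟩
      simp only [LinearMap.pi_apply, Pi.zero_apply] at hzx
      obtain ⟨⟨_, k, rfl⟩, hk⟩ := (IsLocalizedModule.eq_zero_iff (Submonoid.powers x) _).mp hzx
      exact ⟨k, hk⟩
    obtain ⟨n, hn⟩ := Ideal.exists_pow_le_of_le_radical_of_fg hrad ⟨s, hs⟩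
    exact key n z fun r hr ↦ hn hr

end Divisible

/-! ### A decreasing sequence of submodules with intersection a kernel -/

section Tower

variable {R E F : Type*} [CommRing R] [AddCommGroup E] [Module R E] [AddCommGroup F] [Module R F]

/-- The map `E × F^(ℕ) → E × F^ℕ` sending `(e, y)` to `e` together with the sequence that is zero
before the place `n`, and from there on is the constant sequence `f e` changed by `y`. -/
def towerMap (f : E →ₗ[R] F) (n : ℕ) : E × (ℕ →₀ F) →ₗ[R] E × (ℕ → F) where
  toFun v := (v.1, fun j ↦ if j < n then 0 else f v.1 + v.2 (j - n))
  map_add' v w := by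
    ext j
    · simp
    · simp only [Prod.fst_add, Prod.snd_add, map_add, Finsupp.add_apply, Pi.add_apply]
      split_ifs
      · simp
      · abel
  map_smul' r v := by
    ext j
    · simp
    · simp

lemma towerMap_snd_of_lt (f : E →ₗ[R] F) {n j : ℕ} (h : j < n) (v : E × (ℕ →₀ F)) :
    (towerMap f n v).2 j = 0 := if_pos h

lemma towerMap_snd_add (f : E →ₗ[R] F) (n j : ℕ) (v : E × (ℕ →₀ F)) :
    (towerMap f n v).2 (n + j) = f v.1 + v.2 j := by
  simp [towerMap]

lemma towerMap_injective (f : E →ₗ[R] F) (n : ℕ) : Function.Injective (towerMap f n) := by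
  intro v w h
  have h₁ : v.1 = w.1 := congrArg (fun u : E × (ℕ → F) ↦ u.1) h
  refine Prod.ext h₁ (Finsupp.ext fun j ↦ ?_)
  have := congrFun (congrArg Prod.snd h) (n + j)
  rwa [towerMap_snd_add, towerMap_snd_add, h₁, add_right_inj] at this

lemma antitone_range_towerMap (f : E →ₗ[R] F) :
    Antitone fun n ↦ LinearMap.range (towerMap f n) := by
  refine antitone_nat_of_succ_le fun n ↦ ?_
  rintro _ ⟨⟨e, y⟩, rfl⟩
  -- Raising `n` to `n + 1` replaces the entry at the place `n` by zero, a finite change.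
  refine ⟨⟨e, y.mapDomain Nat.succ - Finsupp.single 0 (f e)⟩, ?_⟩
  refine Prod.ext rfl (funext fun j ↦ ?_)
  rcases lt_or_ge j n with hj | hj
  · rw [towerMap_snd_of_lt f hj, towerMap_snd_of_lt f (by lia)]
  · obtain ⟨k, rfl⟩ := Nat.exists_eq_add_of_le hj
    rw [towerMap_snd_add]
    cases k with
    | zero =>
      rw [towerMap_snd_of_lt f (by lia)]
      simp [Finsupp.mapDomain_of_notMem_range]
    | succ k =>
      rw [show n + (k + 1) = n + 1 + k by ring, towerMap_snd_add]
      simp [Finsupp.mapDomain_apply Nat.succ_injective]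

/-- In the intersection of the tower the sequence vanishes, although it is eventually `f e`, so
only the kernel of `f` is left. -/
lemma mem_iInf_range_towerMap (f : E →ₗ[R] F) (v : E × (ℕ → F)) :
    (∀ n, v ∈ LinearMap.range (towerMap f n)) ↔ f v.1 = 0 ∧ v.2 = 0 := by
  constructor
  · intro h
    have hv : v.2 = 0 := by
      funext j
      obtain ⟨w, rfl⟩ := h (j + 1)
      exact towerMap_snd_of_lt f j.lt_succ_self w
    obtain ⟨w, rfl⟩ := h 0
    obtain ⟨j, hj⟩ := Infinite.exists_notMem_finset w.2.support
    have := congrFun hv j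
    rw [← zero_add j, towerMap_snd_add, Finsupp.notMem_support_iff.mp hj, add_zero] at this
    exact ⟨this, hv⟩
  · rintro ⟨h₁, h₂⟩ n
    refine ⟨(v.1, 0), Prod.ext rfl (funext fun j ↦ ?_)⟩
    simp [towerMap, h₁, h₂]

end Tower

/-! ### Vanishing of `Ext` -/

section Ext

open CategoryTheory.Abelian

lemma subsingleton_ext_X₁ {R : Type u} [CommRing R] {S : ShortComplex (ModuleCat.{u} R)}
    (hS : S.ShortExact) (X : ModuleCat.{u} R) (n : ℕ) [Subsingleton (Ext X S.X₃ n)]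
    [Subsingleton (Ext X S.X₂ (n + 1))] : Subsingleton (Ext X S.X₁ (n + 1)) := by
  refine subsingleton_of_forall_eq 0 fun α ↦ ?_
  obtain ⟨β, rfl⟩ := Ext.covariant_sequence_exact₁ X hS α (Subsingleton.elim _ _) rfl
  rw [Subsingleton.elim β 0, Ext.zero_comp]

lemma subsingleton_ext_X₃ {R : Type u} [CommRing R] {S : ShortComplex (ModuleCat.{u} R)}
    (hS : S.ShortExact) (X : ModuleCat.{u} R) (n : ℕ) [Subsingleton (Ext X S.X₂ n)]
    [Subsingleton (Ext X S.X₁ (n + 1))] : Subsingleton (Ext X S.X₃ n) := by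
  refine subsingleton_of_forall_eq 0 fun α ↦ ?_
  obtain ⟨β, rfl⟩ := Ext.covariant_sequence_exact₃ X hS α rfl (Subsingleton.elim _ _)
  rw [Subsingleton.elim β 0, Ext.zero_comp]

lemma subsingleton_ext_zero {R : Type u} [CommRing R] {S : ShortComplex (ModuleCat.{u} R)}
    (hS : S.ShortExact) (X : ModuleCat.{u} R) [Subsingleton (Ext X S.X₂ 0)] :
    Subsingleton (Ext X S.X₁ 0) := by
  have := hS.mono_f
  exact (Ext.postcomp_mk₀_injective_of_mono X S.f).subsingleton

lemma subsingleton_ext_pi {R : Type u} [CommRing R] (X N : ModuleCat.{u} R) (n : ℕ)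
    [Subsingleton (Ext X N n)] (ι : Type) [Fintype ι] :
    Subsingleton (Ext X (ModuleCat.of R (ι → N)) n) := by
  classical
  refine subsingleton_of_forall_eq 0 fun α ↦ ?_
  have hid : 𝟙 (ModuleCat.of R (ι → N)) =
      ∑ i, ModuleCat.ofHom (LinearMap.proj i) ≫
        ModuleCat.ofHom (LinearMap.single R (fun _ ↦ N) i) := by
    refine ModuleCat.hom_ext (LinearMap.ext fun v ↦ ?_)
    simpa [ModuleCat.hom_sum] using (Finset.univ_sum_single v).symm
  rw [← Ext.comp_mk₀_id α, hid, Ext.mk₀_sum, Ext.comp_sum]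
  refine Finset.sum_eq_zero fun i _ ↦ ?_
  rw [← Ext.mk₀_comp_mk₀, ← Ext.comp_assoc_of_second_deg_zero,
    Subsingleton.elim (α.comp (Ext.mk₀ (ModuleCat.ofHom (LinearMap.proj i))) (add_zero n))
      (0 : Ext X N n), Ext.zero_comp]

lemma smul_ext_eq_zero {R : Type u} [CommRing R] {X N : ModuleCat.{u} R} {r : R}
    (hr : r ∈ Module.annihilator R X) {n : ℕ} (α : Ext X N n) : r • α = 0 := by
  have hX : r • 𝟙 X = 0 := by
    ext v
    exact Module.mem_annihilator.mp hr v
  have : r • α = (Ext.mk₀ (r • 𝟙 X)).comp α (zero_add n) := by simp [Ext.mk₀_smul]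
  rw [this, hX, Ext.mk₀_zero, Ext.zero_comp]

/-- If `I` kills `X`, then it kills `Ext X N n`, while the identity of `N` lies in `I • End N`. -/
lemma EndDivisible.subsingleton_ext {R : Type u} [CommRing R] {I : Ideal R}
    {X : ModuleCat.{u} R} (hX : I ≤ Module.annihilator R X) {N : Type u} [AddCommGroup N]
    [Module R N] (h : EndDivisible I N) (n : ℕ) :
    Subsingleton (Ext X (ModuleCat.of R N) n) := by
  refine subsingleton_of_forall_eq 0 fun α ↦ ?_
  have key (q : N →ₗ[R] N) (hq : q ∈ I • (⊤ : Submodule R (N →ₗ[R] N))) :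
      α.comp (Ext.mk₀ (ModuleCat.ofHom q)) (add_zero n) = 0 := by
    induction hq using Submodule.smul_induction_on' with
    | smul r hr q _ =>
      have : ModuleCat.ofHom (r • q) = r • ModuleCat.ofHom q := rfl
      rw [this, Ext.mk₀_smul, Ext.comp_smul, smul_ext_eq_zero (hX hr)]
    | add p _ q _ hp hq =>
      have : ModuleCat.ofHom (p + q) = ModuleCat.ofHom p + ModuleCat.ofHom q := rfl
      rw [this, Ext.mk₀_add, Ext.comp_add, hp, hq, add_zero]
  simpa using key LinearMap.id h

end Ext

/-! ### Modules without socle over a local ring -/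

section ResidueField

open CategoryTheory.Abelian IsLocalRing

variable {R : Type u} [CommRing R] [IsLocalRing R]

lemma maximalIdeal_le_annihilator_residueField :
    maximalIdeal R ≤ Module.annihilator R (ModuleCat.of R (ResidueField R)) :=
  (Ideal.annihilator_quotient (I := maximalIdeal R)).ge

lemma eq_zero_of_subsingleton_ext_zero {N : ModuleCat.{u} R}
    [h : Subsingleton (Ext (ModuleCat.of R (ResidueField R)) N 0)] {z : N}
    (hz : ∀ r ∈ maximalIdeal R, r • z = 0) : z = 0 := by
  let φ : ResidueField R →ₗ[R] N := (maximalIdeal R).liftQ (LinearMap.toSpanSingleton R N z) hz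
  have : Subsingleton (ResidueField R →ₗ[R] N) :=
    (Ext.addEquiv₀.trans (ModuleCat.homAddEquiv (M := .of R (ResidueField R)))).symm.subsingleton
  have h1 : φ (residue R 1) = z := (Submodule.liftQ_apply _ _ _).trans (one_smul R z)
  rw [← h1, Subsingleton.elim φ 0, LinearMap.zero_apply]

/-- A module `M` of Ext-depth at least two is the kernel of a linear map between modules that are
divisible through endomorphisms: both `M` and the cokernel of its embedding have no socle. -/
lemma exists_ker_eq_range_of_subsingleton_ext [IsNoetherianRing R] (M : ModuleCat.{u} R)
    [Subsingleton (Ext (ModuleCat.of R (ResidueField R)) M 0)]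
    [Subsingleton (Ext (ModuleCat.of R (ResidueField R)) M 1)] :
    ∃ (E F : Type u) (_ : AddCommGroup E) (_ : Module R E) (_ : AddCommGroup F) (_ : Module R F)
      (j : M →ₗ[R] E) (f : E →ₗ[R] F), EndDivisible (maximalIdeal R) E ∧
      EndDivisible (maximalIdeal R) F ∧ Function.Injective j ∧
      LinearMap.ker f = LinearMap.range j := by
  have hfg : (maximalIdeal R).FG := IsNoetherian.noetherian _
  obtain ⟨E, _, _, j, hE, hj⟩ := exists_injective_endDivisible hfg
    fun z : M ↦ eq_zero_of_subsingleton_ext_zero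
  let S : ShortComplex (ModuleCat.{u} R) :=
    ModuleCat.shortComplexOfCompEqZero j (LinearMap.range j).mkQ (LinearMap.range_mkQ_comp j)
  have hS : S.ShortExact := ModuleCat.shortComplex_shortExact S
    (LinearMap.exact_map_mkQ_range j) hj (Submodule.mkQ_surjective _)
  have : Subsingleton (Ext (ModuleCat.of R (ResidueField R)) S.X₂ 0) :=
    hE.subsingleton_ext maximalIdeal_le_annihilator_residueField 0
  have : Subsingleton (Ext (ModuleCat.of R (ResidueField R)) S.X₁ (0 + 1)) := by assumption
  have := subsingleton_ext_X₃ hS (ModuleCat.of R (ResidueField R)) 0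
  obtain ⟨F, _, _, i, hF, hi⟩ := exists_injective_endDivisible hfg
    fun z : S.X₃ ↦ eq_zero_of_subsingleton_ext_zero
  refine ⟨E, F, _, _, _, _, j, i ∘ₗ (LinearMap.range j).mkQ, hE, hF, hj, ?_⟩
  rw [LinearMap.ker_comp_of_ker_eq_bot _ (LinearMap.ker_eq_bot.mpr hi), Submodule.ker_mkQ]

end ResidueField

/-! ### Inverse limits of submodules -/

section Limit

/-- A module is the inverse limit of a decreasing sequence of submodules of a module in which it
embeds with image their intersection. -/
lemma limitsOfShape_of_antitone {R : Type u} [CommRing R] {P : ObjectProperty (ModuleCat.{u} R)}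
    {M : ModuleCat.{u} R} {A : Type u} [AddCommGroup A] [Module R A] {T : ℕ → Submodule R A}
    (hT : Antitone T) (hP : ∀ n, P (ModuleCat.of R (T n))) (j : M →ₗ[R] A)
    (hj : Function.Injective j) (hM : ∀ a, a ∈ LinearMap.range j ↔ ∀ n, a ∈ T n) :
    P.limitsOfShape ℕᵒᵖ M := by
  let D : ℕᵒᵖ ⥤ ModuleCat.{u} R :=
    { obj := fun n ↦ ModuleCat.of R (T n.unop)
      map := fun g ↦ ModuleCat.ofHom (Submodule.inclusion (hT (leOfHom g.unop))) }
  let p : (Functor.const ℕᵒᵖ).obj M ⟶ D :=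
    { app := fun n ↦ ModuleCat.ofHom (j.codRestrict (T n.unop) fun m ↦ (hM _).mp ⟨m, rfl⟩ _) }
  -- The components of a cone over the inclusions all have the same underlying map to `A`.
  have hval (s : Limits.Cone D) (z : s.pt) (n : ℕ) :
      ((s.π.app ⟨n⟩).hom z : T n).1 = ((s.π.app ⟨0⟩).hom z : T 0).1 := by
    rw [← s.w (homOfLE n.zero_le).op]
    rfl
  let l (s : Limits.Cone D) : s.pt →ₗ[R] LinearMap.range j :=
    ((T 0).subtype ∘ₗ (s.π.app ⟨0⟩).hom).codRestrict _ fun z ↦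
      (hM _).mpr fun n ↦ by
        have := ((s.π.app ⟨n⟩).hom z : T n).2
        rwa [hval] at this
  have hl (s : Limits.Cone D) (z : s.pt) :
      j ((LinearEquiv.ofInjective j hj).symm (l s z)) = ((s.π.app ⟨0⟩).hom z : T 0).1 :=
    congrArg Subtype.val ((LinearEquiv.ofInjective j hj).apply_symm_apply (l s z))
  refine ⟨{ diag := D, π := p, prop_diag_obj := fun n ↦ hP _, isLimit := ?_ }⟩
  refine
    { lift := fun s ↦ ModuleCat.ofHom ((LinearEquiv.ofInjective j hj).symm.toLinearMap ∘ₗ l s)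
      fac := fun s n ↦ ?_
      uniq := fun s m hm ↦ ?_ }
  · ext z
    exact (hl s z).trans (hval s z n.unop).symm
  · ext z
    refine hj (Eq.trans ?_ (hl s z).symm)
    rw [← hm ⟨0⟩]
    rfl

end Limit

/-! ### Modules of Ext-depth at least two -/

section ExtDepth

open CategoryTheory.Abelian IsLocalRing

variable {R : Type u} [CommRing R] [IsLocalRing R]

lemma subsingleton_ext_of_two_le_extDepth {M : ModuleCat.{u} R} (h : 2 ≤ extDepth R M) {i : ℕ}
    (hi : i < 2) : Subsingleton (Ext (ModuleCat.of R (ResidueField R)) M i) := by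
  by_contra hne
  have : extDepth R M ≤ i := sInf_le ⟨i, rfl, not_subsingleton_iff_nontrivial.mp hne⟩
  exact absurd (h.trans this) (by exact_mod_cast hi.not_ge)

/-- The terms of the tower are isomorphic to `E × F^(ℕ)`, so all their `Ext` groups vanish. -/
lemma limitsOfShape_homologicalCM [IsNoetherianRing R] {M : ModuleCat.{u} R}
    (h : 2 ≤ extDepth R M) : (homologicalCM R).limitsOfShape ℕᵒᵖ M := by
  have := subsingleton_ext_of_two_le_extDepth h zero_lt_two
  have := subsingleton_ext_of_two_le_extDepth h one_lt_two
  obtain ⟨E, F, _, _, _, _, j, f, hE, hF, hj, hjf⟩ := exists_ker_eq_range_of_subsingleton_ext M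
  refine limitsOfShape_of_antitone (antitone_range_towerMap f) (fun n i _ ↦ ?_)
    (LinearMap.inl R E (ℕ → F) ∘ₗ j) (LinearMap.inl_injective.comp hj) fun v ↦ ?_
  · exact ((hE.prod hF.finsupp).of_linearEquiv
      (LinearEquiv.ofInjective _ (towerMap_injective f n))).subsingleton_ext
        maximalIdeal_le_annihilator_residueField i
  · rw [mem_iInf_range_towerMap, ← LinearMap.mem_ker, hjf]
    constructor
    · rintro ⟨m, rfl⟩
      exact ⟨⟨m, rfl⟩, rfl⟩
    · rintro ⟨⟨m, hm⟩, hv⟩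
      exact ⟨m, Prod.ext hm hv.symm⟩

lemma subsingleton_ext_self_of_lt_moduleDepth [IsNoetherianRing R] {i : ℕ}
    (hi : i < moduleDepth R R) :
    Subsingleton (Ext (ModuleCat.of R (ResidueField R)) (ModuleCat.of R R) i) := by
  obtain ⟨_, ⟨rs, hmem, hreg, rfl⟩, hlt⟩ := lt_sSup_iff.mp hi
  refine ModuleCat.subsingleton_ext_of_exists_isRegular (maximalIdeal R) _ ?_ _ ?_ rs hmem hreg i
    (by exact_mod_cast hlt)
  · rw [Module.support_eq_zeroLocus]
    exact PrimeSpectrum.zeroLocus_anti_mono maximalIdeal_le_annihilator_residueField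
  · refine lt_top_iff_ne_top.mpr ?_
    simpa using Ideal.IsPrime.ne_top'

/-- The second syzygy of the residue field, in a resolution by finite free modules, has Ext-depth
exactly two as soon as `Ext^0` and `Ext^1` of the residue field into the ring vanish. -/
lemma exists_extDepth_eq_two [IsNoetherianRing R] (h : 1 < moduleDepth R R) :
    ∃ M : ModuleCat.{u} R, extDepth R M = 2 ∧
      Nontrivial (Ext (ModuleCat.of R (ResidueField R)) M 2) := by
  set k := ModuleCat.of R (ResidueField R)
  have h₀ : Subsingleton (Ext k (ModuleCat.of R R) 0) :=
    subsingleton_ext_self_of_lt_moduleDepth (zero_lt_one.trans h)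
  have h₁ : Subsingleton (Ext k (ModuleCat.of R R) (0 + 1)) :=
    subsingleton_ext_self_of_lt_moduleDepth (by simpa using h)
  let π : R →ₗ[R] ResidueField R := Algebra.linearMap R (ResidueField R)
  have hS := LinearMap.shortExact_shortComplexKer (f := π) residue_surjective
  obtain ⟨n, g, hg⟩ := Module.Finite.exists_fin' R (LinearMap.ker π)
  have hS' := LinearMap.shortExact_shortComplexKer (f := g) hg
  set S := π.shortComplexKer
  set S' := g.shortComplexKer
  have : Subsingleton (Ext k S.X₂ 0) := h₀
  have : Subsingleton (Ext k S.X₂ (0 + 1)) := h₁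
  have : Subsingleton (Ext k S'.X₂ 0) := subsingleton_ext_pi k (ModuleCat.of R R) 0 (Fin n)
  have : Subsingleton (Ext k S'.X₂ (0 + 1)) := subsingleton_ext_pi k (ModuleCat.of R R) _ (Fin n)
  have : Subsingleton (Ext k S'.X₃ 0) := subsingleton_ext_zero hS k
  have hM₀ : Subsingleton (Ext k S'.X₁ 0) := subsingleton_ext_zero hS' k
  have hM₁ : Subsingleton (Ext k S'.X₁ (0 + 1)) := subsingleton_ext_X₁ hS' k 0
  have hM₂ : Nontrivial (Ext k S'.X₁ 2) := by
    by_contra hM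
    rw [not_nontrivial_iff_subsingleton] at hM
    -- Vanishing of `Ext^2(k, M)` would give `Ext^1(k, 𝔪) = 0`, hence `Hom(k, k) = 0`.
    have : Subsingleton (Ext k S'.X₁ (1 + 1)) := hM
    have : Subsingleton (Ext k S'.X₂ 1) := by assumption
    have : Subsingleton (Ext k S.X₁ (0 + 1)) := subsingleton_ext_X₃ hS' k 1
    have : Subsingleton (Ext k k 0) := subsingleton_ext_X₃ hS k 0
    have hz : (1 : ResidueField R) = 0 := eq_zero_of_subsingleton_ext_zero (N := k)
      fun r hr ↦ Module.mem_annihilator.mp (maximalIdeal_le_annihilator_residueField hr) _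
    exact one_ne_zero hz
  refine ⟨S'.X₁, le_antisymm (sInf_le ⟨2, rfl, hM₂⟩) (le_sInf ?_), hM₂⟩
  rintro _ ⟨i, rfl, hi⟩
  match i with
  | 0 => exact absurd hM₀ (not_subsingleton_iff_nontrivial.mpr hi)
  | 1 => exact absurd hM₁ (not_subsingleton_iff_nontrivial.mpr hi)
  | i + 2 => exact_mod_cast Nat.le_add_left 2 i

end ExtDepth

theorem mainTheorem9 (R : Type u) [CommRing R] [IsNoetherianRing R] [IsLocalRing R]
    (hCM : IsCohenMacaulayLocal R) (hdim : 3 ≤ ringKrullDim R) :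
    (∃ M : ModuleCat.{u} R,
      2 ≤ extDepth R M ∧ ((extDepth R M : ℕ∞) : WithBot ℕ∞) < ringKrullDim R) ∧
    (∀ M : ModuleCat.{u} R,
      2 ≤ extDepth R M → ((extDepth R M : ℕ∞) : WithBot ℕ∞) < ringKrullDim R →
        (homologicalCM R).limitsOfShape ℕᵒᵖ M) ∧
    ¬ ClosedUnderInverseLimits (homologicalCM R) := by
  have hlt : (((2 : ℕ) : ℕ∞) : WithBot ℕ∞) < ringKrullDim R := by
    refine lt_of_lt_of_le ?_ hdim
    exact WithBot.coe_lt_coe.mpr (by exact_mod_cast Nat.lt_succ_self 2 : ((2 : ℕ) : ℕ∞) < 3)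
  have hdepth : 1 < moduleDepth R R := by
    rw [← hCM] at hlt
    exact lt_trans (by exact_mod_cast one_lt_two) (WithBot.coe_lt_coe.mp hlt)
  obtain ⟨M, hM, hM₂⟩ := exists_extDepth_eq_two hdepth
  refine ⟨⟨M, hM.ge, hM ▸ hlt⟩, fun N hN _ ↦ limitsOfShape_homologicalCM hN, fun hcl ↦ ?_⟩
  obtain ⟨hlim⟩ := limitsOfShape_homologicalCM hM.ge
  -- Closedness is about index sets in the universe of `R`, whence `ULift ℕ` instead of `ℕ`.
  have := (hcl (ULift.{u} ℕ)).limitsOfShape_le _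
    (hlim.reindex (ULift.orderIso.{u, 0} (α := ℕ)).equivalence.op.functor).limitsOfShape
  exact not_subsingleton_iff_nontrivial.mpr hM₂ (this 2 hlt)
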